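/- Let $G$ be a finite group, let $K$ be a field whose characteristic does not divide $|G|$, and let $K(G)$ be the group algebra, with basis $\{e_g\}_{g\in G}$ and centre $ZK(G)$. Let $m$ be the number of conjugacy classes of $G$ and let $P'$ be the set of conjugacy classes different from $\{1\}$. For $\lambda\in P'$ put $\alpha_\lambda=\sum_{g\in\lambda}e_g\in ZK(G)$, let $\pi:K[\{x_\lambda\}_{\lambda\in P'}]\to ZK(G)$ be the homomorphism of $K$-algebras with $\pi(x_\lambda)=\alpha_\lambda$, and let $I=\ker\pi$. Let $V(I)$ be the set of common zeros of $I$ in the affine space $\overline{K}^{P'}$ over an algebraic closure $\overline K$ of $K$, and assume that all points of $V(I)$ have their coordinates in $K$. Then: 1. The map $\pi$ is surjective, so that $ZK(G)\cong K[\{x_\lambda\}_{\lambda\in P'}]/I$. The set $V(I)$ consists of exactly $m$ points $a_1,\dots,a_m$, and evaluation of polynomials at these points induces an isomorphism of $K$-algebras $\mathrm{ev}:ZK(G)\cong K[\{x_\lambda\}]/I\to K^m$, $\mathrm{ev}(\pi(f))=(f(a_1),\dots,f(a_m))$. 2. Let $\beta_i\in ZK(G)$ be the preimage under $\mathrm{ev}$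 of the $i$-th vector of the canonical basis of $K^m$. Then $\beta_1,\dots,\beta_m$ are primitive central idempotents of $K(G)$ (that is, each $\beta_i$ is a nonzero central idempotent that is not the sum of two nonzero orthogonal central idempotents), $\beta_i\beta_j=0$ for $i\ne j$, and $\beta_1+\dots+\beta_m=1$. 3. The group $G$ has, up to isomorphism, exactly $m$ irreducible representations over $K$. They can be listed as $\rho_1:G\to Aut(V_1),\dots,\rho_m:G\to Aut(V_m)$ in such a way that the following holds. Put $W_i=\beta_iK(G)$, an algebra with unit $\beta_i$, and let $\tilde\rho_i:K(G)\to End(V_i)$ be the homomorphism of $K$-algebras that extends $\rho_i$. Then $x\mapsto(\beta_1x,\dots,\beta_mx)$ is an isomorphism of $K$-algebras $K(G)\cong\bigoplus_{i=1}^mW_i$, and, for each $i$, the restriction of $\tilde\rho_i$ to $W_i$ is an isomorphism of $K$-algebras from $W_i$ onto the image of $\tilde\rho_i$. -/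

import Mathlib

open scoped MonoidAlgebra

noncomputable section

namespace GroupAlgebraPoints

/-- The conjugacy classes of `G` other than the class of the identity. -/
abbrev NontrivialClass (G : Type*) [Group G] : Type _ :=
  {c : ConjClasses G // c ≠ ConjClasses.mk 1}

open scoped Classical in
/-- The class sum `∑ g ∈ c, e_g` in the group algebra. -/
def classSum (K : Type*) {G : Type*} [Field K] [Group G] [Fintype G] (c : ConjClasses G) :
    K[G] :=
  ∑ g : G with ConjClasses.mk g = c, MonoidAlgebra.single g 1

theorem classSum_mem_center (K : Type*) {G : Type*} [Field K] [Group G] [Fintype G]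
    (c : ConjClasses G) : classSum K c ∈ Subalgebra.center K K[G] := by
  classical
  rw [Subalgebra.mem_center_iff]
  intro b
  induction b using MonoidAlgebra.induction_on with
  | of h =>
    simp only [classSum, MonoidAlgebra.of_apply, Finset.mul_sum, Finset.sum_mul,
      MonoidAlgebra.single_mul_single, one_mul]
    refine Finset.sum_bij' (fun g _ => h * g * h⁻¹) (fun g _ => h⁻¹ * g * h) ?_ ?_ ?_ ?_ ?_
    · intro g hg
      simp only [Finset.mem_filter, Finset.mem_univ, true_and] at hg ⊢
      rw [← hg, ConjClasses.mk_eq_mk_iff_isConj]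
      exact (isConj_iff.2 ⟨h, rfl⟩).symm
    · intro g hg
      simp only [Finset.mem_filter, Finset.mem_univ, true_and] at hg ⊢
      rw [← hg, ConjClasses.mk_eq_mk_iff_isConj]
      exact (isConj_iff.2 ⟨h⁻¹, by simp⟩).symm
    · intro g _; group
    · intro g _; group
    · intro g _; simp
  | add x y hx hy => rw [add_mul, mul_add, hx, hy]
  | smul r x hx => rw [smul_mul_assoc, mul_smul_comm, hx]

/-- The homomorphism of `K`-algebras `K[x_c : c ≠ class of 1] → Z(K[G])`, `x_c ↦ classSum c`. -/
def classPresentation (K G : Type*) [Field K] [Group G] [Fintype G] :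
    MvPolynomial (NontrivialClass G) K →ₐ[K] Subalgebra.center K K[G] :=
  MvPolynomial.aeval fun c => ⟨classSum K c.1, classSum_mem_center K c.1⟩

/-- The ideal `I` of relations among the class sums. -/
def classIdeal (K G : Type*) [Field K] [Group G] [Fintype G] :
    Ideal (MvPolynomial (NontrivialClass G) K) :=
  RingHom.ker (classPresentation K G)

/-- A primitive central idempotent: a nonzero central idempotent that is not the sum of two
nonzero orthogonal central idempotents. -/
structure IsPrimitiveCentralIdempotent {A : Type*} [Ring A] (b : A) : Prop where
  ne_zero : b ≠ 0
  idem : IsIdempotentElem b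
  central : b ∈ Subring.center A
  primitive : ∀ e f : A, IsIdempotentElem e → IsIdempotentElem f →
    e ∈ Subring.center A → f ∈ Subring.center A → e * f = 0 → e + f = b → e = 0 ∨ f = 0

/-- The ring `b A b`, with unit `b`, is a `K`-algebra with the scalar multiplication of `A`. For
central `b` it is the block `b A`. -/
instance cornerAlgebra {K A : Type*} [Field K] [Ring A] [Algebra K A] {b : A}
    (hb : IsIdempotentElem b) : Algebra K hb.Corner where
  smul r x := ⟨r • x.1, by
    obtain ⟨y, hy⟩ := x.2
    exact ⟨r • y, by simp only [← hy, mul_smul_comm, smul_mul_assoc]⟩⟩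
  algebraMap :=
    { toFun := fun r => ⟨r • b, r • b, by
        simp only [mul_smul_comm, smul_mul_assoc, hb.eq]⟩
      map_one' := Subtype.ext (one_smul K b)
      map_mul' := fun r s => Subtype.ext (by
        change (r * s) • b = (r • b) * (s • b)
        rw [smul_mul_smul_comm, hb.eq])
      map_zero' := Subtype.ext (zero_smul K b)
      map_add' := fun r s => Subtype.ext (add_smul r s b) }
  commutes' r x := Subtype.ext (by
    change (r • b) * x.1 = x.1 * (r • b)
    have h := (Subsemigroup.mem_corner_iff hb).mp x.2
    rw [smul_mul_assoc, mul_smul_comm, h.1, h.2])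
  smul_def' r x := Subtype.ext (by
    change r • x.1 = (r • b) * x.1
    have h := (Subsemigroup.mem_corner_iff hb).mp x.2
    rw [smul_mul_assoc, h.1])

end GroupAlgebraPoints

end

universe u v w

open GroupAlgebraPoints

/-! ### Central idempotents and blocks of a semisimple ring -/

section SemisimpleRing

variable {A : Type*} [Ring A] [IsSemisimpleRing A]

/-! By Maschke, `K[G]` is semisimple, so its centre is reduced; the class sums give it dimension
`m`. Homomorphisms from the centre to `L` are the `L`-points of `V(I)`. When all geometric points
are rational, reducedness makes evaluation at the `K`-points injective and Dedekind independence
makes it surjective, so the centre is `K ^ m` with `m` points.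

The canonical basis of `K ^ m` then gives the blocks. The annihilator of a module is generated by a
central idempotent, so primitivity makes a block act faithfully on any nonzero module belonging to
it (`eq_zero_of_forall_smul_eq_zero`). Hence each block has just one simple module and is isomorphic
to its image there; no Wedderburn matrix form is needed. -/

/-- A two-sided ideal of a semisimple ring is generated by a central idempotent. -/
theorem IsSemisimpleRing.exists_central_idempotent_of_isTwoSided (I : Ideal A) [hI : I.IsTwoSided] :
    ∃ e ∈ Subring.center A, IsIdempotentElem e ∧ e ∈ I ∧ ∀ x ∈ I, x * e = x := by
  -- Two-sided ideals are the fully invariant submodules, which correspond to sets of isotypic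
  -- components; complements exist there.
  have : ComplementedLattice (fullyInvariantSubmodule A A) :=
    (OrderIso.setIsotypicComponents (R := A) (M := A)).complementedLattice
  obtain ⟨⟨J', hJ⟩, hIJ⟩ := exists_isCompl
    (⟨I, isFullyInvariant_iff_isTwoSided.2 hI⟩ : fullyInvariantSubmodule A A)
  let J : Ideal A := J'
  have hJ' : J.IsTwoSided := isFullyInvariant_iff_isTwoSided.1 hJ
  have hinf : I ⊓ J = ⊥ := congrArg Subtype.val hIJ.inf_eq_bot
  have hsup : I ⊔ J = ⊤ := congrArg Subtype.val hIJ.sup_eq_top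
  have hzero : ∀ x, x ∈ I → x ∈ J → x = 0 := fun x h₁ h₂ => by
    have : x ∈ I ⊓ J := ⟨h₁, h₂⟩
    rwa [hinf] at this
  obtain ⟨e, he, f, hf, hef⟩ := Submodule.mem_sup.1 (hsup ▸ Submodule.mem_top : (1 : A) ∈ I ⊔ J)
  have hIe : ∀ x ∈ I, x * e = x := fun x hx => by
    have h := hzero (x * f) (I.mul_mem_right f hx) (J.mul_mem_left x hf)
    calc x * e = x * (e + f) := by rw [mul_add, h, add_zero]
      _ = x := by rw [hef, mul_one]
  have heI : ∀ x ∈ I, e * x = x := fun x hx => by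
    have h := hzero (f * x) (I.mul_mem_left f hx) (J.mul_mem_right x hf)
    calc e * x = (e + f) * x := by rw [add_mul, h, add_zero]
      _ = x := by rw [hef, one_mul]
  refine ⟨e, Subring.mem_center_iff.2 fun x => ?_, hIe e he, he, hIe⟩
  obtain ⟨a, ha, b, hb, rfl⟩ := Submodule.mem_sup.1 (hsup ▸ Submodule.mem_top : x ∈ I ⊔ J)
  rw [add_mul, mul_add, hIe a ha, heI a ha,
    hzero (b * e) (I.mul_mem_left b he) (J.mul_mem_right e hb),
    hzero (e * b) (I.mul_mem_right b he) (J.mul_mem_left e hb)]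

/-- The centre of a semisimple ring has no nonzero nilpotent elements. -/
theorem IsSemisimpleRing.eq_zero_of_isNilpotent_of_mem_center {z : A}
    (hz : z ∈ Subring.center A) (hn : IsNilpotent z) : z = 0 := by
  have h : z ∈ Ring.jacobson A := by
    rw [← Ideal.jacobson_bot, Ideal.mem_jacobson_iff]
    intro y
    have hc : Commute y z := Subring.mem_center_iff.1 hz y
    -- Centrality makes every multiple `y * z` nilpotent, which places `z` in the Jacobson radical.
    have hu : IsUnit (y * z + 1) := (hc.isNilpotent_mul_left hn).isUnit_add_one
    obtain ⟨u, hu⟩ := hu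
    refine ⟨↑u⁻¹, ?_⟩
    have : (↑u⁻¹ : A) * y * z + ↑u⁻¹ = ↑u⁻¹ * ↑u := by rw [hu, mul_add, mul_one, mul_assoc]
    rw [this, Units.inv_mul, sub_self]
    exact Submodule.zero_mem _
  rwa [IsSemisimpleRing.jacobson_eq_bot] at h

/-- A block of a semisimple ring acts faithfully on every nonzero module that belongs to it. -/
theorem GroupAlgebraPoints.IsPrimitiveCentralIdempotent.eq_zero_of_forall_smul_eq_zero
    {b : A} (hb : IsPrimitiveCentralIdempotent b) {S : Type*} [AddCommGroup S] [Module A S]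
    [Nontrivial S] (hS : ∀ s : S, b • s = s) {x : A} (hx : b * x = x)
    (hxS : ∀ s : S, x • s = 0) : x = 0 := by
  obtain ⟨e, hec, hee, heI, heN⟩ :=
    IsSemisimpleRing.exists_central_idempotent_of_isTwoSided (Module.annihilator A S)
  have hbc := Subring.mem_center_iff.1 hb.central
  have hec' := Subring.mem_center_iff.1 hec
  have hbe : IsIdempotentElem (b * e) := hb.idem.mul_of_commute (hec' b) hee
  have hbe' : IsIdempotentElem (b * (1 - e)) :=
    hb.idem.mul_of_commute (hbc (1 - e)).symm hee.one_sub
  have hcen : 1 - e ∈ Subring.center A := sub_mem (one_mem _) hec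
  -- Split `b` along the generator `e` of the annihilator: `b * e = 0` forces `x = 0`, while `b * (1
  -- - e) = 0` would make `b` kill `S`.
  have key := hb.primitive (b * e) (b * (1 - e)) hbe hbe' (mul_mem hb.central hec)
    (mul_mem hb.central hcen)
    (by rw [mul_assoc, ← mul_assoc e, ← hec' b, mul_assoc b e, mul_sub, mul_one, hee.eq, sub_self,
      mul_zero, mul_zero])
    (by rw [← mul_add, add_sub_cancel, mul_one])
  rcases key with h | h
  · have hxe : x * e = x := heN x (Module.mem_annihilator.2 hxS)
    rw [← hxe, ← hx, mul_assoc, hec' x, ← mul_assoc, h, zero_mul]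
  · obtain ⟨s, hs⟩ := exists_ne (0 : S)
    have h0 : (b * (1 - e)) • s = 0 := by rw [h, zero_smul]
    rw [mul_smul, hS, sub_smul, one_smul, Module.mem_annihilator.1 heI s, sub_zero] at h0
    exact absurd h0 hs

/-- Two simple modules that belong to the same block are isomorphic. -/
theorem GroupAlgebraPoints.IsPrimitiveCentralIdempotent.nonempty_linearEquiv
    {b : A} (hb : IsPrimitiveCentralIdempotent b) {S T : Type*} [AddCommGroup S] [Module A S]
    [IsSimpleModule A S] [AddCommGroup T] [Module A T] [IsSimpleModule A T]
    (hS : ∀ s : S, b • s = s) (hT : ∀ t : T, b • t = t) : Nonempty (T ≃ₗ[A] S) := by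
  obtain ⟨L, ⟨φ⟩⟩ := IsSemisimpleRing.exists_linearEquiv_ideal_of_isSimpleModule A T
  have hL : IsSimpleModule A L := IsSimpleModule.congr φ.symm
  have : Nontrivial S := IsSimpleModule.nontrivial A S
  have : Nontrivial L := IsSimpleModule.nontrivial A L
  have hbL : ∀ l : L, b • l = l := fun l => by
    rw [← φ.apply_symm_apply l, ← map_smul, hT]
  obtain ⟨l, hl⟩ := exists_ne (0 : L)
  have hex : ∃ s : S, (l : A) • s ≠ 0 := by
    by_contra! h
    exact hl (Subtype.ext (hb.eq_zero_of_forall_smul_eq_zero hS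
      (congrArg Subtype.val (hbL l)) h))
  obtain ⟨s, hs⟩ := hex
  -- Schur's lemma applies to right multiplication by `s`, nonzero because `l` does not kill `s`.
  let f : L →ₗ[A] S := (LinearMap.toSpanSingleton A S s).comp L.subtype
  have hf : f ≠ 0 := fun h => hs (by simpa [f] using LinearMap.congr_fun h l)
  exact ⟨φ.trans (LinearEquiv.ofBijective f (LinearMap.bijective_of_ne_zero hf))⟩

/-- A nonzero central idempotent acts as the identity on some simple left ideal. -/
theorem IsSemisimpleRing.exists_isSimpleModule_forall_smul_eq {b : A} (hb : b ≠ 0)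
    (hi : IsIdempotentElem b) (hc : b ∈ Subring.center A) :
    ∃ L : Ideal A, IsSimpleModule A L ∧ ∀ l : L, b • l = l := by
  have hne : Ideal.span {b} ≠ ⊥ := by simpa using hb
  obtain ⟨L, hle, hL⟩ := (IsSemisimpleModule.eq_bot_or_exists_simple_le
    (Ideal.span {b} : Ideal A)).resolve_left hne
  refine ⟨L, hL, fun l => Subtype.ext ?_⟩
  obtain ⟨a, ha⟩ := Ideal.mem_span_singleton'.1 (hle l.2)
  change b * (l : A) = l
  rw [← ha, ← Subring.mem_center_iff.1 hc, mul_assoc, hi.eq]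

end SemisimpleRing

/-- A central idempotent acts on a simple module as zero or as the identity. -/
theorem IsSimpleModule.forall_smul_eq_of_smul_ne_zero {A S : Type*} [Ring A] [AddCommGroup S]
    [Module A S] [IsSimpleModule A S] {b : A} (hi : IsIdempotentElem b)
    (hc : b ∈ Subring.center A) {s : S} (hs : b • s ≠ 0) (t : S) : b • t = t := by
  have h : Submodule.span A {b • s} = ⊤ := IsSimpleModule.span_singleton_eq_top A hs
  obtain ⟨a, rfl⟩ := Submodule.mem_span_singleton.1 (h ▸ Submodule.mem_top : t ∈ _)
  rw [smul_smul, smul_smul, ← Subring.mem_center_iff.1 hc, mul_assoc, hi.eq, ← smul_smul]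

/-! ### Finite-dimensional commutative algebras and their points -/

section SplitAlgebra

variable (K : Type*) (Z : Type*) [Field K] [CommRing Z] [Algebra K Z]

/-- Evaluation of the elements of `Z` at the `K`-points of `Z`. -/
def evalAtPoints : Z →ₐ[K] ((Z →ₐ[K] K) → K) :=
  AlgHom.pi fun χ => χ

variable [FiniteDimensional K Z]

/-- A functional vanishing on the range is a linear relation between distinct characters, hence zero
by Dedekind. -/
theorem evalAtPoints_surjective : Function.Surjective (evalAtPoints K Z) := by
  have hli := linearIndependent_algHom_toLinearMap K Z K
  have : Finite (Z →ₐ[K] K) := inferInstance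
  have : Fintype (Z →ₐ[K] K) := Fintype.ofFinite _
  classical
  rw [← AlgHom.coe_toLinearMap, ← LinearMap.range_eq_top, ← Subspace.dualAnnihilator_inj,
    Submodule.dualAnnihilator_top, eq_bot_iff]
  intro φ hφ
  rw [Submodule.mem_dualAnnihilator] at hφ
  have hrep : ∀ v, φ v = ∑ χ, φ (Pi.single χ 1) * v χ := fun v => by
    conv_lhs => rw [pi_eq_sum_univ' v]
    simp [mul_comm]
  have h0 : ∀ χ, φ (Pi.single χ 1) = 0 := by
    refine Fintype.linearIndependent_iff.1 hli (fun χ => φ (Pi.single χ 1)) ?_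
    ext z
    have := hφ _ ⟨z, rfl⟩
    rw [hrep] at this
    simpa [evalAtPoints] using this
  refine (Submodule.mem_bot _).2 (LinearMap.ext fun v => ?_)
  rw [hrep]
  simp [h0]

/-- A nonzero `z` avoids some prime `M`. The field `Z ⧸ M` is algebraic over `K` and embeds in the
closure, giving a character that is nonzero at `z` and, by `h`, takes values in `K`. -/
theorem evalAtPoints_injective [IsReduced Z]
    (h : ∀ χ : Z →ₐ[K] AlgebraicClosure K, ∀ z, χ z ∈ (algebraMap K (AlgebraicClosure K)).range) :
    Function.Injective (evalAtPoints K Z) := by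
  rw [injective_iff_map_eq_zero]
  intro z hz
  by_contra hne
  have hnil : ¬ IsNilpotent z := fun hn => hne hn.eq_zero
  rw [← mem_nilradical, nilradical_eq_sInf, Submodule.mem_sInf] at hnil
  push Not at hnil
  obtain ⟨M', hM, hzM⟩ := hnil
  let M : Ideal Z := M'
  have hM' : M.IsPrime := hM
  have : Algebra.IsIntegral K (Z ⧸ M) := inferInstance
  let e : (Z ⧸ M) →ₐ[K] AlgebraicClosure K := IsAlgClosed.lift
  let χ : Z →ₐ[K] AlgebraicClosure K := e.comp (Ideal.Quotient.mkₐ K M)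
  have hr : ∀ z, χ z ∈ (Algebra.ofId K (AlgebraicClosure K)).range := h χ
  let ι := AlgEquiv.ofInjectiveField (Algebra.ofId K (AlgebraicClosure K))
  let χ' : Z →ₐ[K] K := ι.symm.toAlgHom.comp (χ.codRestrict _ hr)
  have h0 : χ' z = 0 := congrFun hz χ'
  have h1 : χ z = 0 := by
    have : χ.codRestrict _ hr z = 0 := ι.symm.map_eq_zero_iff.1 h0
    exact congrArg Subtype.val this
  have hinj : Function.Injective e := by
    have : IsField (Z ⧸ M) := isField_of_isIntegral_of_isField' (Field.toIsField K)
    let := this.toField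
    exact e.toRingHom.injective
  have h2 : Ideal.Quotient.mkₐ K M z = 0 := hinj (by rw [map_zero]; exact h1)
  exact hzM (Ideal.Quotient.eq_zero_iff_mem.1 h2)

end SplitAlgebra

/-! ### Class sums, the centre and the points of `V(I)` -/

namespace GroupAlgebraPoints

theorem coeff_eq_of_mem_center {K G : Type*} [Field K] [Group G] {z : K[G]}
    (hz : z ∈ Subalgebra.center K K[G]) {g h : G} (hgh : IsConj g h) :
    z.coeff g = z.coeff h := by
  obtain ⟨c, rfl⟩ := isConj_iff.1 hgh
  have := congrArg (fun y => y.coeff (c * g))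
    (Subalgebra.mem_center_iff.1 hz (MonoidAlgebra.single c 1))
  simpa using this

section ClassSums

variable {K G : Type*} [Field K] [Group G] [Fintype G]

theorem coeff_classSum (c : ConjClasses G) (g : G) [Decidable (ConjClasses.mk g = c)] :
    (classSum K c).coeff g = if ConjClasses.mk g = c then 1 else 0 := by
  classical
  simp only [classSum, MonoidAlgebra.coeff_sum, Finset.sum_filter, Finsupp.finsetSum_apply]
  rw [Finset.sum_eq_single g]
  · split_ifs <;> simp
  · intro h _ hne
    split_ifs <;> simp [hne]
  · simp

theorem classSum_one : classSum K (ConjClasses.mk (1 : G)) = 1 := by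
  classical
  ext g
  rw [coeff_classSum]
  simp [MonoidAlgebra.one_def, Finsupp.single_apply, ConjClasses.mk_eq_mk_iff_isConj, eq_comm]

variable (K G) in
/-- The class sums form a basis of the centre of the group algebra. -/
noncomputable def centerEquivFun [Fintype (ConjClasses G)] :
    (ConjClasses G → K) ≃ₗ[K] Subalgebra.center K K[G] :=
  LinearEquiv.ofBijective
    (Fintype.linearCombination K fun c : ConjClasses G =>
      (⟨classSum K c, classSum_mem_center K c⟩ : Subalgebra.center K K[G])) <| by
    classical
    have hcoeff : ∀ (f : ConjClasses G → K) (g : G),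
        (∑ c, f c • classSum K c : K[G]).coeff g = f (ConjClasses.mk g) := fun f g => by
      simp [MonoidAlgebra.coeff_sum, coeff_classSum]
    constructor
    · intro f₁ f₂ h
      funext c
      obtain ⟨g, rfl⟩ := ConjClasses.exists_rep c
      have h' := congrArg (fun z : Subalgebra.center K K[G] => (z : K[G]).coeff g) h
      simpa [Fintype.linearCombination_apply, -MonoidAlgebra.coeff_sum, hcoeff] using h'
    · intro z
      refine ⟨fun c => (z : K[G]).coeff (Quotient.out c), Subtype.ext ?_⟩
      ext g
      have hg : IsConj (Quotient.out (ConjClasses.mk g)) g :=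
        ConjClasses.mk_eq_mk_iff_isConj.1 (Quotient.out_eq _)
      simpa [Fintype.linearCombination_apply, -MonoidAlgebra.coeff_sum, hcoeff] using
        coeff_eq_of_mem_center z.2 hg

variable (K G) in
theorem finrank_center :
    Module.finrank K (Subalgebra.center K K[G]) = Nat.card (ConjClasses G) := by
  have : Fintype (ConjClasses G) := Fintype.ofFinite _
  rw [← (centerEquivFun K G).finrank_eq, Module.finrank_fintype_fun_eq_card,
    Nat.card_eq_fintype_card]

variable (K G) in
theorem classPresentation_surjective : Function.Surjective (classPresentation K G) := by
  have : Fintype (ConjClasses G) := Fintype.ofFinite _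
  rw [← AlgHom.range_eq_top, eq_top_iff]
  intro z _
  obtain ⟨f, rfl⟩ := (centerEquivFun K G).surjective z
  change ∑ c, f c • _ ∈ _
  refine sum_mem fun c _ => Subalgebra.smul_mem _ ?_ _
  -- The identity class has no variable, but its sum is the unit.
  by_cases hc : c = ConjClasses.mk 1
  · subst hc
    convert one_mem (classPresentation K G).range
    exact classSum_one
  · exact ⟨MvPolynomial.X ⟨c, hc⟩, by simp [classPresentation]⟩

variable (L : Type*) [Field L] [Algebra K L]

theorem aeval_classSum_eq (χ : Subalgebra.center K K[G] →ₐ[K] L)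
    (f : MvPolynomial (NontrivialClass G) K) :
    MvPolynomial.aeval (fun c : NontrivialClass G =>
      χ (classPresentation K G (MvPolynomial.X c))) f = χ (classPresentation K G f) :=
  (MvPolynomial.comp_aeval_apply (fun c => classPresentation K G (MvPolynomial.X c)) χ f).symm.trans
    (by simp [classPresentation])

variable (K G) in
/-- The `L`-points of `V(I)` are the homomorphisms of `K`-algebras from the centre to `L`. -/
noncomputable def algHomEquivZeroLocus :
    (Subalgebra.center K K[G] →ₐ[K] L) ≃ MvPolynomial.zeroLocus L (classIdeal K G) :=
  Equiv.ofBijective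
    (fun χ => ⟨fun c => χ (classPresentation K G (MvPolynomial.X c)), fun f hf => by
      rw [aeval_classSum_eq, show classPresentation K G f = 0 from hf, map_zero]⟩) <| by
    have hs := classPresentation_surjective K G
    constructor
    · intro χ₁ χ₂ h
      ext z
      obtain ⟨f, rfl⟩ := hs z
      rw [← aeval_classSum_eq, ← aeval_classSum_eq]
      exact congrArg (fun a => MvPolynomial.aeval a f) (congrArg Subtype.val h)
    · rintro ⟨a, ha⟩
      -- Evaluation at a point of `V(I)` kills `I`, so it descends to the centre.
      let χ := AlgHom.liftOfSurjective (classPresentation K G) hs (MvPolynomial.aeval a)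
        (fun f hf => ha f hf)
      refine ⟨χ, Subtype.ext (funext fun c => ?_)⟩
      exact (AlgHom.liftOfSurjective_apply (classPresentation K G) hs (MvPolynomial.aeval a)
        (fun f hf => ha f hf) (MvPolynomial.X c)).trans (MvPolynomial.aeval_X a c)

theorem aeval_algHomEquivZeroLocus (χ : Subalgebra.center K K[G] →ₐ[K] L)
    (f : MvPolynomial (NontrivialClass G) K) :
    MvPolynomial.aeval (algHomEquivZeroLocus K G L χ).1 f = χ (classPresentation K G f) :=
  aeval_classSum_eq L χ f

theorem isSemisimpleRing_of_not_dvd (hchar : ¬ ringChar K ∣ Nat.card G) :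
    IsSemisimpleRing K[G] := by
  have : NeZero (Nat.card G : K) := ⟨fun h => hchar ((ringChar.spec K _).1 h)⟩
  infer_instance

theorem isReduced_center (hchar : ¬ ringChar K ∣ Nat.card G) :
    IsReduced (Subalgebra.center K K[G]) := by
  have := isSemisimpleRing_of_not_dvd hchar
  exact ⟨fun z hz => Subtype.ext <| IsSemisimpleRing.eq_zero_of_isNilpotent_of_mem_center z.2
    (hz.map (Subalgebra.center K K[G]).val)⟩

/-- If all points of `V(I)` are defined over `K`, evaluation at them identifies the centre with
a power of `K`. -/
theorem exists_center_algEquiv_pi (hchar : ¬ ringChar K ∣ Nat.card G)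
    (hpts : ∀ a ∈ MvPolynomial.zeroLocus (AlgebraicClosure K) (classIdeal K G),
      ∀ c, a c ∈ (algebraMap K (AlgebraicClosure K)).range) :
    ∃ (a : Fin (Nat.card (ConjClasses G)) ≃ MvPolynomial.zeroLocus K (classIdeal K G))
      (ev : Subalgebra.center K K[G] ≃ₐ[K] (Fin (Nat.card (ConjClasses G)) → K)),
      ∀ f i, ev (classPresentation K G f) i = MvPolynomial.aeval (a i).1 f := by
  have := isReduced_center hchar
  have hfin : FiniteDimensional K (Subalgebra.center K K[G]) :=
    have : Fintype (ConjClasses G) := Fintype.ofFinite _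
    (centerEquivFun K G).finiteDimensional
  have hK : ∀ χ : Subalgebra.center K K[G] →ₐ[K] AlgebraicClosure K, ∀ z,
      χ z ∈ (algebraMap K (AlgebraicClosure K)).range := by
    intro χ z
    obtain ⟨f, rfl⟩ := classPresentation_surjective K G z
    let p := algHomEquivZeroLocus K G (AlgebraicClosure K) χ
    rw [← aeval_algHomEquivZeroLocus]
    choose q hq using hpts p.1 p.2
    refine ⟨MvPolynomial.aeval q f, ?_⟩
    have hp : p.1 = algebraMap K (AlgebraicClosure K) ∘ q := funext fun c => (hq c).symm
    change _ = MvPolynomial.aeval p.1 f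
    rw [hp, MvPolynomial.aeval_algebraMap_apply]
  let E : Subalgebra.center K K[G] ≃ₐ[K] ((Subalgebra.center K K[G] →ₐ[K] K) → K) :=
    AlgEquiv.ofBijective (evalAtPoints K _)
      ⟨evalAtPoints_injective K _ hK, evalAtPoints_surjective K _⟩
  have hcard : Nat.card (Subalgebra.center K K[G] →ₐ[K] K) = Nat.card (ConjClasses G) := by
    have : Fintype (Subalgebra.center K K[G] →ₐ[K] K) := Fintype.ofFinite _
    rw [← finrank_center K G, E.toLinearEquiv.finrank_eq, Module.finrank_fintype_fun_eq_card,
      Nat.card_eq_fintype_card]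
  let n := (Finite.equivFinOfCardEq hcard).symm
  refine ⟨n.trans (algHomEquivZeroLocus K G K),
    E.trans (AlgEquiv.piCongrLeft K (fun _ => K) n).symm, fun f i => ?_⟩
  rw [Equiv.trans_apply, aeval_algHomEquivZeroLocus]
  rfl

end ClassSums
end GroupAlgebraPoints

namespace GroupAlgebraPoints

/-! ### Idempotents from a split centre -/

section Blocks

variable {K A : Type*} [Field K] [Ring A] [Algebra K A] {ι : Type*}

/-- An isomorphism of the centre with a power of `K` sends the canonical basis to primitive
central idempotents. -/
theorem isPrimitiveCentralIdempotent_symm_single [DecidableEq ι]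
    (ev : Subalgebra.center K A ≃ₐ[K] (ι → K)) (i : ι) :
    IsPrimitiveCentralIdempotent (ev.symm (Pi.single i 1) : A) where
  ne_zero h := by
    have h' : ev.symm (Pi.single i 1) = 0 := Subtype.ext h
    rw [EmbeddingLike.map_eq_zero_iff] at h'
    simpa using congrFun h' i
  idem := by
    have h : IsIdempotentElem (Pi.single i 1 : ι → K) := by
      simp [IsIdempotentElem, ← Pi.single_mul]
    exact congrArg Subtype.val (h.map ev.symm)
  central := (ev.symm (Pi.single i 1)).2
  primitive e f he hf hec hfc hef hsum := by
    obtain ⟨e, rfl⟩ : ∃ e' : Subalgebra.center K A, (e' : A) = e := ⟨⟨e, hec⟩, rfl⟩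
    obtain ⟨f, rfl⟩ : ∃ f' : Subalgebra.center K A, (f' : A) = f := ⟨⟨f, hfc⟩, rfl⟩
    have he' : ev e * ev e = ev e := by rw [← map_mul]; exact congrArg ev (Subtype.ext he)
    have hf' : ev f * ev f = ev f := by rw [← map_mul]; exact congrArg ev (Subtype.ext hf)
    have hef' : ev e * ev f = 0 := by
      rw [← map_mul, ← map_zero ev]; exact congrArg ev (Subtype.ext hef)
    have hsum' : ev e + ev f = Pi.single i 1 := by
      rw [← map_add, ← ev.apply_symm_apply (Pi.single i 1)]
      exact congrArg ev (Subtype.ext hsum)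
    have hoff : ∀ j, j ≠ i → ev e j = 0 ∧ ev f j = 0 := by
      intro j hj
      have h₁ : ev e j * ev e j = ev e j := congrFun he' j
      have h₂ : ev e j * ev f j = 0 := congrFun hef' j
      have h₃ : ev e j + ev f j = 0 := by simpa [hj] using congrFun hsum' j
      -- Multiplying `h₃` by `ev e j` leaves only its square, which equals itself.
      have h₄ : ev e j = 0 := by linear_combination -h₁ - h₂ + ev e j * h₃
      exact ⟨h₄, by simpa [h₄] using h₃⟩
    have hzero : ∀ x : Subalgebra.center K A, (∀ j, ev x j = 0) → (x : A) = 0 := fun x hx => by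
      rw [(EmbeddingLike.map_eq_zero_iff (f := ev)).1 (funext hx), ZeroMemClass.coe_zero]
    rcases mul_eq_zero.1 (congrFun hef' i) with h | h
    · exact Or.inl (hzero e fun j => if hj : j = i then hj ▸ h else (hoff j hj).1)
    · exact Or.inr (hzero f fun j => if hj : j = i then hj ▸ h else (hoff j hj).2)

theorem completeOrthogonalIdempotents_symm_single [Fintype ι] [DecidableEq ι]
    (ev : Subalgebra.center K A ≃ₐ[K] (ι → K)) :
    CompleteOrthogonalIdempotents fun i => (ev.symm (Pi.single i 1) : A) :=
  (CompleteOrthogonalIdempotents.single fun _ : ι => K).map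
    ((Subalgebra.center K A).val.toRingHom.comp ev.symm.toRingEquiv.toRingHom)

/-- A complete family of central orthogonal idempotents decomposes the algebra. -/
theorem exists_algEquiv_pi_corner [Fintype ι] {b : ι → A} (hb : CompleteOrthogonalIdempotents b)
    (hc : ∀ i, b i ∈ Subring.center A) :
    ∃ φ : A ≃ₐ[K] (∀ i, (hb.idem i).Corner), ∀ x i, (φ x i).1 = b i * x := by
  have hval : ∀ x i, b i * x * b i = b i * x := fun x i => by
    rw [mul_assoc, Subring.mem_center_iff.1 (hc i) x, ← mul_assoc, (hb.idem i).eq]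
  have hc' : ∀ i, IsMulCentral (b i) := hc
  refine ⟨AlgEquiv.ofRingEquiv (f := hb.ringEquivOfIsMulCentral hc') fun r => ?_, fun x i => ?_⟩
  · funext i
    refine Subtype.ext ?_
    change b i * algebraMap K A r * b i = r • b i
    rw [hval, Algebra.algebraMap_eq_smul_one, mul_smul_comm, mul_one]
  · exact hval x i

end Blocks

/-! ### Representations as modules over the group algebra -/

section Representations

variable {K G : Type*} [Field K] [Group G]

theorem asAlgebraHom_ofModule' (M : Type*) [AddCommGroup M] [Module K M] [Module K[G] M]
    [IsScalarTower K K[G] M] (x : K[G]) (m : M) :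
    (Representation.ofModule' (k := K) (G := G) M).asAlgebraHom x m = x • m := by
  rw [Representation.asAlgebraHom_def, Representation.ofModule', Equiv.apply_symm_apply]
  rfl

/-- The identification of `M` with the module of the representation on `M`. -/
noncomputable def asModuleOfModule'Equiv (M : Type*) [AddCommGroup M] [Module K M] [Module K[G] M]
    [IsScalarTower K K[G] M] :
    (Representation.ofModule' (k := K) (G := G) M).asModule ≃ₗ[K[G]] M where
  __ := (Representation.asModuleEquiv (Representation.ofModule' (k := K) (G := G) M)).toAddEquiv
  map_smul' x m := asAlgebraHom_ofModule' M x m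

variable {V W : Type*} [AddCommGroup V] [Module K V] [AddCommGroup W] [Module K W]
  {ρ : Representation K G V} {σ : Representation K G W}

/-- An isomorphism of the modules of two representations is an equivalence of representations. -/
theorem nonempty_equiv_of_asModule (e : ρ.asModule ≃ₗ[K[G]] σ.asModule) :
    Nonempty (ρ.Equiv σ) :=
  ⟨((Representation.IntertwiningMap.equivLinearMapAsModule ρ σ).symm e.toLinearMap).ofBijective
    e.bijective⟩

theorem asAlgebraHom_apply_of_equiv (e : ρ.Equiv σ) (x : K[G]) (v : V) :
    e (ρ.asAlgebraHom x v) = σ.asAlgebraHom x (e v) :=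
  (Representation.IntertwiningMap.equivLinearMapAsModule ρ σ e.toIntertwiningMap).map_smul x v

/-- A block is isomorphic to its image under an irreducible representation that belongs to it. -/
theorem exists_corner_algEquiv_range [IsSemisimpleRing K[G]] [Nontrivial V] {b : K[G]}
    (hb : IsPrimitiveCentralIdempotent b) (hi : IsIdempotentElem b)
    (hρ : ρ.asAlgebraHom b = 1) :
    ∃ ψ : hi.Corner ≃ₐ[K] ρ.asAlgebraHom.range,
      ∀ x, (ψ x : Module.End K V) = ρ.asAlgebraHom x.1 := by
  let f : hi.Corner →ₐ[K] ρ.asAlgebraHom.range :=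
    { toFun := fun x => ⟨ρ.asAlgebraHom x.1, x.1, rfl⟩
      map_one' := Subtype.ext hρ
      map_mul' := fun x y => Subtype.ext (map_mul ρ.asAlgebraHom x.1 y.1)
      map_zero' := Subtype.ext (map_zero ρ.asAlgebraHom)
      map_add' := fun x y => Subtype.ext (map_add ρ.asAlgebraHom x.1 y.1)
      commutes' := fun r => Subtype.ext <| by
        change ρ.asAlgebraHom (r • b) = algebraMap K (Module.End K V) r
        rw [map_smul, hρ, Algebra.algebraMap_eq_smul_one] }
  refine ⟨AlgEquiv.ofBijective f ⟨?_, ?_⟩, fun x => rfl⟩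
  · rw [injective_iff_map_eq_zero]
    intro x hx
    have h0 : ρ.asAlgebraHom x.1 = 0 := congrArg Subtype.val hx
    have : Nontrivial ρ.asModule := inferInstanceAs (Nontrivial V)
    exact Subtype.ext <| hb.eq_zero_of_forall_smul_eq_zero (S := ρ.asModule)
      (fun s => LinearMap.congr_fun hρ s) ((Subsemigroup.mem_corner_iff hi).1 x.2).1
      (fun s => LinearMap.congr_fun h0 s)
  · rintro ⟨_, x, rfl⟩
    refine ⟨⟨b * x * b, x, rfl⟩, Subtype.ext ?_⟩
    change ρ.asAlgebraHom (b * x * b) = ρ.asAlgebraHom x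
    rw [map_mul, map_mul, hρ, one_mul, mul_one]

end Representations

end GroupAlgebraPoints

/-! ### Assembly of the theorem -/

theorem theorem2p12 {K : Type u} {G : Type v} [Field K] [Group G] [Fintype G]
    (hchar : ¬ ringChar K ∣ Nat.card G)
    -- every point of `V(I)` over the algebraic closure has its coordinates in `K`
    (hpts : ∀ a ∈ MvPolynomial.zeroLocus (AlgebraicClosure K) (classIdeal K G),
      ∀ c, a c ∈ (algebraMap K (AlgebraicClosure K)).range)
    (m : ℕ) (hm : m = Nat.card (ConjClasses G)) :
    -- the class sums present the centre: `Z(K[G]) ≅ K[x] / I`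
    Function.Surjective (classPresentation K G) ∧
    -- `V(I)` consists of `m` points `a 0, …, a (m - 1)`, and evaluating at them is an
    -- isomorphism `Z(K[G]) ≅ K[x] / I ≅ K ^ m`
    ∃ (a : Fin m ≃ MvPolynomial.zeroLocus K (classIdeal K G))
      (ev : Subalgebra.center K K[G] ≃ₐ[K] (Fin m → K)),
      (∀ f i, ev (classPresentation K G f) i = MvPolynomial.aeval (a i).1 f) ∧
    -- the preimages `β i` of the canonical basis
    ∃ β : Fin m → K[G],
      (∀ i, β i = (ev.symm (Pi.single i 1) : K[G])) ∧
      (∀ i, IsPrimitiveCentralIdempotent (β i)) ∧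
    ∃ hβ : CompleteOrthogonalIdempotents β,
    -- the irreducible representations of `G` are `ρ 0, …, ρ (m - 1)`, up to isomorphism
    ∃ (V : Fin m → Type (max u v)) (_ : ∀ i, AddCommGroup (V i)) (_ : ∀ i, Module K (V i))
      (ρ : ∀ i, Representation K G (V i)),
      (∀ i, (ρ i).IsIrreducible) ∧
      (∀ i j, i ≠ j → IsEmpty ((ρ i).Equiv (ρ j))) ∧
      (∀ (U : Type w) [AddCommGroup U] [Module K U] (σ : Representation K G U),
        σ.IsIrreducible → ∃ i, Nonempty (σ.Equiv (ρ i))) ∧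
    -- `K[G]` is the direct sum of the algebras `W i = β i K[G]`
      (∃ φ : K[G] ≃ₐ[K] (∀ i, (hβ.idem i).Corner), ∀ x i, (φ x i).1 = β i * x) ∧
    -- and `W i` is isomorphic to the image of `K[G] → End (V i)`
      (∀ i, ∃ ψ : (hβ.idem i).Corner ≃ₐ[K] (ρ i).asAlgebraHom.range,
        ∀ x, (ψ x : Module.End K (V i)) = (ρ i).asAlgebraHom x.1) := by

  subst hm
  refine ⟨classPresentation_surjective K G, ?_⟩
  obtain ⟨a, ev, hev⟩ := exists_center_algEquiv_pi hchar hpts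
  have hss : IsSemisimpleRing K[G] := isSemisimpleRing_of_not_dvd hchar
  let β : Fin (Nat.card (ConjClasses G)) → K[G] := fun i => (ev.symm (Pi.single i 1) : K[G])
  have hprim : ∀ i, IsPrimitiveCentralIdempotent (β i) :=
    isPrimitiveCentralIdempotent_symm_single ev
  have hβ : CompleteOrthogonalIdempotents β := completeOrthogonalIdempotents_symm_single ev
  choose L hL hβL using fun i => IsSemisimpleRing.exists_isSimpleModule_forall_smul_eq
    (hprim i).ne_zero (hprim i).idem (hprim i).central
  let ρ := fun i => Representation.ofModule' (k := K) (G := G) (L i)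
  have hρβ : ∀ i, (ρ i).asAlgebraHom (β i) = 1 := fun i =>
    LinearMap.ext fun v => (asAlgebraHom_ofModule' (L i) (β i) v).trans (hβL i v)
  have hnt : ∀ i, Nontrivial (L i) := fun i => IsSimpleModule.nontrivial K[G] (L i)
  refine ⟨a, ev, hev, β, fun _ => rfl, hprim, hβ, fun i => L i, inferInstance, inferInstance, ρ,
    fun i => ?_, fun i j hij => ⟨fun e => ?_⟩, fun U _ _ σ hσ => ?_,
    exists_algEquiv_pi_corner hβ fun i => (hprim i).central,
    fun i => exists_corner_algEquiv_range (hprim i) (hβ.idem i) (hρβ i)⟩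
  · rw [Representation.irreducible_iff_isSimpleModule_asModule]
    exact IsSimpleModule.congr (asModuleOfModule'Equiv (L i))
  · obtain ⟨v, hv⟩ := exists_ne (0 : L i)
    -- `β i` separates the two: it is the identity on `L i` and zero on `L j`.
    have h : (ρ j).asAlgebraHom (β i) = 0 := by
      rw [← mul_one ((ρ j).asAlgebraHom (β i)), ← hρβ j, ← map_mul, hβ.ortho hij, map_zero]
    have h' := asAlgebraHom_apply_of_equiv e (β i) v
    rw [h, hρβ i, Module.End.one_apply, LinearMap.zero_apply] at h'
    exact hv (e.toLinearEquiv.map_eq_zero_iff.1 h')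
  · have hs : IsSimpleModule K[G] σ.asModule :=
      (Representation.irreducible_iff_isSimpleModule_asModule σ).1 hσ
    have : Nontrivial σ.asModule := IsSimpleModule.nontrivial K[G] σ.asModule
    obtain ⟨s, hs0⟩ := exists_ne (0 : σ.asModule)
    -- The `β i` sum to one, so some block does not kill `s`; it then acts as the identity on all of
    -- `σ`.
    obtain ⟨i, hi⟩ : ∃ i, β i • s ≠ 0 := by
      by_contra! h
      apply hs0
      rw [← one_smul K[G] s, ← hβ.complete, Finset.sum_smul]
      exact Finset.sum_eq_zero fun i _ => h i
    obtain ⟨e⟩ := (hprim i).nonempty_linearEquiv (hβL i)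
      (IsSimpleModule.forall_smul_eq_of_smul_ne_zero (hprim i).idem (hprim i).central hi)
    exact ⟨i, nonempty_equiv_of_asModule (e.trans (asModuleOfModule'Equiv (L i)).symm)⟩
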